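/- Let $\mathbb{H}^3$ be hyperbolic 3-space (curvature $-1$) with a fixed origin $0\in\mathbb{H}^3$, and identify its group of orientation-preserving isometries with $\mathrm{PSL}_2(\mathbb{C})=\mathbb{CP}^3\setminus Q$, where a point $(z_0:z_1:z_2:z_3)\in\mathbb{CP}^3$ is regarded as the matrix $\begin{pmatrix} z_0&z_1\\ z_2&z_3\end{pmatrix}$ up to scale and $Q=\{z_0z_3-z_1z_2=0\}$ is the quadric of degenerate matrices. Let $\varkappa:\mathbb{CP}^3\setminus Q\to\mathbb{H}^3$, $\varkappa(z)=z(0)$. Concretely, one may take $\mathbb{H}^3$ to be the set of positive definite Hermitian $2\times2$ matrices of determinant $1$ with the distance $d(X,Y)=\operatorname{arcosh}\bigl(\tfrac12\operatorname{tr}(X^{-1}Y)\bigr)$, on which an invertible matrix $A$ acts by $X\mapsto|\det A|^{-1}AXA^*$, and $0$ to be the identity matrix, so that $\varkappa(A)=|\det A|^{-1}AA^*$. For an algebraic surface $S\subset\mathbb{CP}^3$, i.e. the zero locus of a nonzero homogeneous polynomial of positive degree (not necessarily irreducible), let $\mathcal{A}_S=\varkappa(S\setminus Q)\subset\mathbb{H}^3$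 be its hyperbolic amoeba. A set $K\subset\mathbb{H}^3$ is called convex if for all $x,y\in K$ the geodesic segment $[x,y]$ is contained in $K$. Theorem. For every algebraic surface $S\subset\mathbb{CP}^3$ different from the quadric $Q$, the complement $\mathbb{H}^3\setminus\mathcal{A}_S$ is an open convex subset of $\mathbb{H}^3$. In particular, it is connected (the empty set, which may occur, being counted as connected). -/

import Mathlib

open scoped Matrix ComplexOrder LinearAlgebra.Projectivization

namespace HyperbolicAmoeba

/-! ### Hyperbolic 3-space (Hermitian matrix model) -/

/-- The points of hyperbolic 3-space: positive definite Hermitian `2 × 2` matrices of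
determinant `1`, that is, the upper sheet of the unit hyperboloid of the Lorentzian quadratic
form `det` on the four-dimensional real space of Hermitian matrices. -/
@[ext]
structure H3 where
  /-- The underlying matrix. -/
  mat : Matrix (Fin 2) (Fin 2) ℂ
  posDef : mat.PosDef
  det_eq_one : mat.det = 1

namespace H3

/-- The topology induced from the space of matrices. -/
noncomputable instance : TopologicalSpace H3 := TopologicalSpace.induced H3.mat inferInstance

theorem continuous_mat : Continuous H3.mat := continuous_induced_dom

/-- The origin of hyperbolic space, the identity matrix. -/
def origin : H3 := ⟨1, Matrix.PosDef.one, Matrix.det_one⟩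

theorem act_mem (g : GL (Fin 2) ℂ) (X : H3) :
    ((‖g.1.det‖⁻¹ : ℝ) • (g.1 * X.mat * g.1ᴴ)).PosDef ∧
      ((‖g.1.det‖⁻¹ : ℝ) • (g.1 * X.mat * g.1ᴴ)).det = 1 := by
  have hg : g.1.det ≠ 0 := ((Matrix.isUnit_iff_isUnit_det _).1 g.isUnit).ne_zero
  have hn : 0 < ‖g.1.det‖ := norm_pos_iff.2 hg
  constructor
  · refine Matrix.PosDef.smul ?_ (inv_pos.2 hn)
    refine X.posDef.mul_mul_conjTranspose_same ?_
    exact Matrix.vecMul_injective_iff_isUnit.2 g.isUnit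
  · have h1 : ((‖g.1.det‖⁻¹ : ℝ) • (g.1 * X.mat * g.1ᴴ)) =
        ((‖g.1.det‖⁻¹ : ℝ) : ℂ) • (g.1 * X.mat * g.1ᴴ) := by
      ext i j; simp
    rw [h1, Matrix.det_smul, Matrix.det_mul, Matrix.det_mul, X.det_eq_one, Matrix.det_conjTranspose]
    have h2 : g.1.det * star g.1.det = ((‖g.1.det‖ : ℝ) : ℂ) ^ 2 := by
      rw [← Complex.mul_conj']; rfl
    have hn' : ((‖g.1.det‖ : ℝ) : ℂ) ≠ 0 := by exact_mod_cast hn.ne'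
    rw [mul_one, h2, Fintype.card_fin]
    push_cast
    field_simp

/-- The action of invertible matrices on hyperbolic space, `g • X = |det g|⁻¹ g X g*`. Scalar
matrices act trivially, and on the absolute (rank one matrices `v v*` up to scale) the action is
`v v* ↦ (g v) (g v)*`, the Möbius action on the complex projective line. -/
noncomputable instance : MulAction (GL (Fin 2) ℂ) H3 where
  smul g X := ⟨(‖g.1.det‖⁻¹ : ℝ) • (g.1 * X.mat * g.1ᴴ), (act_mem g X).1, (act_mem g X).2⟩
  one_smul X := by
    refine H3.ext ?_
    change (‖(1 : Matrix (Fin 2) (Fin 2) ℂ).det‖⁻¹ : ℝ) •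
      ((1 : Matrix (Fin 2) (Fin 2) ℂ) * X.mat * (1 : Matrix (Fin 2) (Fin 2) ℂ)ᴴ) = X.mat
    simp
  mul_smul g h X := by
    refine H3.ext ?_
    change (‖(g.1 * h.1).det‖⁻¹ : ℝ) • ((g.1 * h.1) * X.mat * (g.1 * h.1)ᴴ) =
      (‖g.1.det‖⁻¹ : ℝ) • (g.1 * ((‖h.1.det‖⁻¹ : ℝ) • (h.1 * X.mat * h.1ᴴ)) * g.1ᴴ)
    rw [Matrix.conjTranspose_mul, Matrix.det_mul, norm_mul, mul_inv, Matrix.mul_smul,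
      Matrix.smul_mul, smul_smul]
    simp only [Matrix.mul_assoc]

theorem mat_smul (g : GL (Fin 2) ℂ) (X : H3) :
    (g • X).mat = (‖g.1.det‖⁻¹ : ℝ) • (g.1 * X.mat * g.1ᴴ) := rfl

/-- The hyperbolic cosine of the distance. -/
noncomputable def coshDist (X Y : H3) : ℝ := (X.mat⁻¹ * Y.mat).trace.re / 2

/-- The hyperbolic distance of curvature `-1`. -/
noncomputable def hdist (X Y : H3) : ℝ := Real.arcosh (coshDist X Y)

theorem coshDist_smul (g : GL (Fin 2) ℂ) (X Y : H3) :
    coshDist (g • X) (g • Y) = coshDist X Y := by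
  have hg : IsUnit g.1.det := (Matrix.isUnit_iff_isUnit_det _).1 g.isUnit
  have hn : 0 < ‖g.1.det‖ := norm_pos_iff.2 hg.ne_zero
  have hX : IsUnit X.mat.det := by rw [X.det_eq_one]; exact isUnit_one
  have hgc : IsUnit (g.1ᴴ).det := by rw [Matrix.det_conjTranspose]; exact hg.star
  set r : ℝ := ‖g.1.det‖ with hr
  have hinv : ((r⁻¹ : ℝ) • (g.1 * X.mat * g.1ᴴ))⁻¹ = (r : ℝ) • ((g.1ᴴ)⁻¹ * (X.mat⁻¹ * g.1⁻¹)) := by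
    apply Matrix.inv_eq_left_inv
    rw [Matrix.smul_mul, Matrix.mul_smul, smul_smul, mul_inv_cancel₀ hn.ne', one_smul]
    calc (g.1ᴴ)⁻¹ * (X.mat⁻¹ * g.1⁻¹) * (g.1 * X.mat * g.1ᴴ)
        = (g.1ᴴ)⁻¹ * (X.mat⁻¹ * (g.1⁻¹ * g.1) * X.mat) * g.1ᴴ := by simp only [Matrix.mul_assoc]
      _ = 1 := by
        rw [Matrix.nonsing_inv_mul _ hg, Matrix.mul_one, Matrix.nonsing_inv_mul _ hX,
          Matrix.mul_one, Matrix.nonsing_inv_mul _ hgc]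
  unfold coshDist
  rw [mat_smul, mat_smul, ← hr, hinv, Matrix.smul_mul, Matrix.mul_smul, smul_smul,
    mul_inv_cancel₀ hn.ne', one_smul]
  have : (g.1ᴴ)⁻¹ * (X.mat⁻¹ * g.1⁻¹) * (g.1 * Y.mat * g.1ᴴ) =
      (g.1ᴴ)⁻¹ * (X.mat⁻¹ * Y.mat) * g.1ᴴ := by
    calc (g.1ᴴ)⁻¹ * (X.mat⁻¹ * g.1⁻¹) * (g.1 * Y.mat * g.1ᴴ)
        = (g.1ᴴ)⁻¹ * (X.mat⁻¹ * (g.1⁻¹ * g.1) * Y.mat) * g.1ᴴ := by simp only [Matrix.mul_assoc]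
      _ = _ := by rw [Matrix.nonsing_inv_mul _ hg, Matrix.mul_one]
  rw [this, Matrix.trace_mul_comm, ← Matrix.mul_assoc, Matrix.mul_nonsing_inv _ hgc,
    Matrix.one_mul]

theorem hdist_smul (g : GL (Fin 2) ℂ) (X Y : H3) : hdist (g • X) (g • Y) = hdist X Y := by
  rw [hdist, coshDist_smul, hdist]

/-- Every point is given by real numbers `p, q > 0` and a complex number `z = a + b i` with
`p q - |z|² = 1`. -/
theorem exists_coord (X : H3) : ∃ p q a b : ℝ, 0 < p ∧ 0 < q ∧ p * q - (a ^ 2 + b ^ 2) = 1 ∧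
    X.mat = !![(p : ℂ), ⟨a, b⟩; ⟨a, -b⟩, (q : ℂ)] := by
  have h := X.posDef
  have h0 := h.diag_pos (i := 0)
  have h1 := h.diag_pos (i := 1)
  have h01 := h.1.apply 1 0
  have hdet := X.det_eq_one
  rw [Complex.lt_def] at h0 h1
  have e00 : X.mat 0 0 = ((X.mat 0 0).re : ℂ) := Complex.ext (by simp) (by simpa using h0.2.symm)
  have e11 : X.mat 1 1 = ((X.mat 1 1).re : ℂ) := Complex.ext (by simp) (by simpa using h1.2.symm)
  have e10 : X.mat 1 0 = ⟨(X.mat 0 1).re, -(X.mat 0 1).im⟩ := by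
    rw [← h01]; rfl
  refine ⟨(X.mat 0 0).re, (X.mat 1 1).re, (X.mat 0 1).re, (X.mat 0 1).im, by simpa using h0.1,
    by simpa using h1.1, ?_, ?_⟩
  · rw [Matrix.det_fin_two, e10, e00, e11] at hdet
    have := congrArg Complex.re hdet
    simp at this
    nlinarith [this]
  · ext i j
    fin_cases i <;> fin_cases j
    · simpa using e00
    · simp
    · simpa using e10
    · simpa using e11

theorem coshDist_coord {X Y : H3} {p q a b p' q' a' b' : ℝ}
    (hX : X.mat = !![(p : ℂ), ⟨a, b⟩; ⟨a, -b⟩, (q : ℂ)])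
    (hY : Y.mat = !![(p' : ℂ), ⟨a', b'⟩; ⟨a', -b'⟩, (q' : ℂ)]) :
    coshDist X Y = (q * p' + p * q') / 2 - (a * a' + b * b') := by
  have hinv : X.mat⁻¹ = X.mat.adjugate := by
    rw [Matrix.inv_def, X.det_eq_one]; simp
  rw [coshDist, hinv, hX, hY, Matrix.adjugate_fin_two]
  simp [Matrix.trace_fin_two]
  ring

theorem origin_coord : origin.mat = !![((1 : ℝ) : ℂ), ⟨0, 0⟩; ⟨0, -0⟩, ((1 : ℝ) : ℂ)] := by
  ext i j
  fin_cases i <;> fin_cases j <;> simp [origin, Complex.ext_iff]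

theorem exists_smul_origin (X : H3) : ∃ g : GL (Fin 2) ℂ, g • origin = X := by
  obtain ⟨p, q, a, b, -, hq, h, hX⟩ := exists_coord X
  set c := Real.sqrt q with hc
  have hcpos : 0 < c := Real.sqrt_pos.2 hq
  have hcc : c * c = q := Real.mul_self_sqrt hq.le
  have hc0 : (c : ℂ) ≠ 0 := by exact_mod_cast hcpos.ne'
  have hdet : (!![((c⁻¹ : ℝ) : ℂ), ⟨a / c, b / c⟩; 0, (c : ℂ)]).det = 1 := by
    rw [Matrix.det_fin_two_of]; push_cast; field_simp; simp
  refine ⟨Matrix.GeneralLinearGroup.mkOfDetNeZero _ (by rw [hdet]; exact one_ne_zero),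
    H3.ext ?_⟩
  rw [mat_smul]
  change (‖(!![((c⁻¹ : ℝ) : ℂ), ⟨a / c, b / c⟩; 0, (c : ℂ)]).det‖⁻¹ : ℝ) •
    (!![((c⁻¹ : ℝ) : ℂ), ⟨a / c, b / c⟩; 0, (c : ℂ)] * 1 *
      (!![((c⁻¹ : ℝ) : ℂ), ⟨a / c, b / c⟩; 0, (c : ℂ)])ᴴ) = X.mat
  rw [hdet, hX, norm_one, inv_one, one_smul, Matrix.mul_one]
  have hp : p = (1 + a ^ 2 + b ^ 2) / (c * c) := by
    rw [hcc]; field_simp; linarith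
  ext i j
  fin_cases i <;> fin_cases j <;> apply Complex.ext <;>
    simp [Matrix.mul_apply, Matrix.conjTranspose_apply, Fin.sum_univ_two, hcc]
  · rw [hp, ← hcc]; field_simp; ring
  · ring
  all_goals field_simp

theorem coshDist_comm (X Y : H3) : coshDist X Y = coshDist Y X := by
  obtain ⟨p, q, a, b, -, -, -, hX⟩ := exists_coord X
  obtain ⟨p', q', a', b', -, -, -, hY⟩ := exists_coord Y
  rw [coshDist_coord hX hY, coshDist_coord hY hX]; ring

theorem one_le_coshDist (X Y : H3) : 1 ≤ coshDist X Y := by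
  obtain ⟨g, rfl⟩ := exists_smul_origin X
  obtain ⟨Z, rfl⟩ : ∃ Z, g • Z = Y := ⟨g⁻¹ • Y, smul_inv_smul g Y⟩
  rw [coshDist_smul]
  obtain ⟨p, q, a, b, hp, hq, h, hZ⟩ := exists_coord Z
  rw [coshDist_coord origin_coord hZ]
  nlinarith [sq_nonneg (p - q), sq_nonneg a, sq_nonneg b, add_pos hp hq]

theorem eq_of_coshDist_eq_one {X Y : H3} (hd : coshDist X Y = 1) : X = Y := by
  obtain ⟨g, rfl⟩ := exists_smul_origin X
  obtain ⟨Z, rfl⟩ : ∃ Z, g • Z = Y := ⟨g⁻¹ • Y, smul_inv_smul g Y⟩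
  rw [coshDist_smul] at hd
  congr 1
  obtain ⟨p, q, a, b, hp, hq, h, hZ⟩ := exists_coord Z
  rw [coshDist_coord origin_coord hZ] at hd
  have hq' : q = 2 - p := by linarith
  subst hq'
  have e : (p - 1) ^ 2 + a ^ 2 + b ^ 2 = 0 := by linarith
  have e1 : p = 1 := by nlinarith [sq_nonneg (p - 1), sq_nonneg a, sq_nonneg b]
  have e2 : a = 0 := by nlinarith [sq_nonneg (p - 1), sq_nonneg a, sq_nonneg b]
  have e3 : b = 0 := by nlinarith [sq_nonneg (p - 1), sq_nonneg a, sq_nonneg b]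
  refine H3.ext ?_
  rw [hZ, origin_coord, e1, e2, e3]
  norm_num

theorem coshDist_self (X : H3) : coshDist X X = 1 := by
  obtain ⟨p, q, a, b, hp, hq, h, hX⟩ := exists_coord X
  rw [coshDist_coord hX hX]; linarith

theorem hdist_triangle (X Y Z : H3) : hdist X Z ≤ hdist X Y + hdist Y Z := by
  have h0 : ∀ X Y : H3, 0 ≤ hdist X Y := fun X Y => Real.arcosh_nonneg (one_le_coshDist X Y)
  have key : coshDist X Z ≤ Real.cosh (hdist X Y + hdist Y Z) := by
    rw [Real.cosh_add, hdist, hdist, Real.cosh_arcosh (one_le_coshDist _ _),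
      Real.cosh_arcosh (one_le_coshDist _ _), Real.sinh_arcosh (one_le_coshDist _ _),
      Real.sinh_arcosh (one_le_coshDist _ _)]
    obtain ⟨g, rfl⟩ := exists_smul_origin Y
    obtain ⟨X, rfl⟩ : ∃ X', g • X' = X := ⟨g⁻¹ • X, smul_inv_smul g X⟩
    obtain ⟨Z, rfl⟩ : ∃ Z', g • Z' = Z := ⟨g⁻¹ • Z, smul_inv_smul g Z⟩
    rw [coshDist_smul, coshDist_smul, coshDist_smul]
    obtain ⟨p, q, a, b, -, -, h, hX⟩ := exists_coord X
    obtain ⟨p', q', a', b', -, -, h', hZ⟩ := exists_coord Z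
    rw [coshDist_coord hX hZ, coshDist_coord hX origin_coord, coshDist_coord origin_coord hZ,
      ← Real.sqrt_mul' _ (by nlinarith [sq_nonneg (p' - q'), sq_nonneg a', sq_nonneg b'])]
    have hs : (q * p' + p * q') / 2 - (a * a' + b * b') -
        (p + q) / 2 * ((p' + q') / 2) ≤
        √((((p + q) / 2) ^ 2 - 1) * (((p' + q') / 2) ^ 2 - 1)) := by
      apply Real.le_sqrt_of_sq_le
      have e1 : ((p + q) / 2) ^ 2 - 1 = ((p - q) / 2) ^ 2 + a ^ 2 + b ^ 2 := by linarith
      have e2 : ((p' + q') / 2) ^ 2 - 1 = ((p' - q') / 2) ^ 2 + a' ^ 2 + b' ^ 2 := by linarith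
      rw [e1, e2]
      nlinarith [sq_nonneg ((p - q) / 2 * a' - a * ((p' - q') / 2)),
        sq_nonneg ((p - q) / 2 * b' - b * ((p' - q') / 2)), sq_nonneg (a * b' - b * a')]
    ring_nf at hs ⊢
    linarith
  calc hdist X Z ≤ Real.arcosh (Real.cosh (hdist X Y + hdist Y Z)) :=
        (Real.arcosh_le_arcosh (by linarith [one_le_coshDist X Z])
          (Real.cosh_pos _)).2 key
    _ = _ := Real.arcosh_cosh (add_nonneg (h0 _ _) (h0 _ _))

theorem continuous_smul_left (g : GL (Fin 2) ℂ) : Continuous fun X : H3 => g • X := by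
  refine continuous_induced_rng.2 ?_
  have hv := continuous_mat
  change Continuous fun X : H3 => (‖g.1.det‖⁻¹ : ℝ) • (g.1 * X.mat * g.1ᴴ)
  fun_prop

theorem continuous_hdist (X : H3) : Continuous fun Y : H3 => hdist X Y := by
  have hv := continuous_mat
  refine Real.continuousOn_arcosh.comp_continuous ?_ (fun Y => one_le_coshDist X Y)
  unfold coshDist
  fun_prop

theorem isOpen_iff_hdist (s : Set H3) :
    IsOpen s ↔ ∀ X ∈ s, ∃ ε > 0, ∀ Y, hdist X Y < ε → Y ∈ s := by
  constructor
  · intro hs X hX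
    obtain ⟨g, rfl⟩ := exists_smul_origin X
    have hs' := hs.preimage (continuous_smul_left g)
    obtain ⟨U, hU, hUs⟩ := isOpen_induced_iff.1 hs'
    have hoU : origin.mat ∈ U := by
      have : origin ∈ (fun X : H3 => g • X) ⁻¹' s := hX
      rw [← hUs] at this; exact this
    obtain ⟨δ, hδ, hball⟩ := Metric.isOpen_iff.1
      (show IsOpen (X := Fin 2 → Fin 2 → ℂ) U from hU) origin.mat hoU
    have hc : 1 < Real.sqrt (1 + δ ^ 2 / 4) := by
      rw [Real.lt_sqrt (by norm_num)]; nlinarith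
    refine ⟨Real.arcosh (Real.sqrt (1 + δ ^ 2 / 4)), Real.arcosh_pos hc, fun Y hY => ?_⟩
    obtain ⟨Z, rfl⟩ : ∃ Z, g • Z = Y := ⟨g⁻¹ • Y, smul_inv_smul g Y⟩
    rw [hdist_smul, hdist, Real.arcosh_lt_arcosh (by linarith [one_le_coshDist origin Z])
      (by linarith)] at hY
    change Z ∈ (fun X : H3 => g • X) ⁻¹' s
    rw [← hUs]
    have h1 := one_le_coshDist origin Z
    obtain ⟨p, q, a, b, hp, hq, h, hZ⟩ := exists_coord Z
    rw [coshDist_coord origin_coord hZ] at hY h1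
    have hY2 := (Real.lt_sqrt (by linarith)).1 hY
    have hsum : (p - 1) ^ 2 + (q - 1) ^ 2 + 2 * (a ^ 2 + b ^ 2) < δ ^ 2 := by
      nlinarith
    have hab : a ^ 2 + b ^ 2 < δ ^ 2 := by
      nlinarith [sq_nonneg (p - 1), sq_nonneg (q - 1), sq_nonneg a, sq_nonneg b]
    have hz : ∀ w : ℂ, w.re ^ 2 + w.im ^ 2 < δ ^ 2 → ‖w‖ < δ := by
      intro w hw
      refine lt_of_pow_lt_pow_left₀ 2 hδ.le ?_
      rw [Complex.sq_norm, Complex.normSq_apply]; nlinarith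
    have key : ∀ i j, dist (Z.mat i j) (origin.mat i j) < δ := by
      intro i j
      rw [dist_eq_norm, hZ, origin_coord]
      fin_cases i <;> fin_cases j <;> apply hz <;> simp <;>
        nlinarith [sq_nonneg (p - 1), sq_nonneg (q - 1), sq_nonneg a, sq_nonneg b]
    exact hball ((dist_pi_lt_iff hδ).2 fun i => (dist_pi_lt_iff hδ).2 fun j => key i j)
  · intro h
    rw [isOpen_iff_mem_nhds]
    intro X hX
    obtain ⟨ε, hε, hs⟩ := h X hX
    refine Filter.mem_of_superset (IsOpen.mem_nhds
      (isOpen_lt (continuous_hdist X) continuous_const) ?_) hs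
    change hdist X X < ε
    rw [hdist, coshDist_self, Real.arcosh_zero]; exact hε

/-- Hyperbolic 3-space with its hyperbolic metric. -/
noncomputable instance : MetricSpace H3 :=
  MetricSpace.ofDistTopology hdist
    (fun X => by rw [hdist, coshDist_self, Real.arcosh_zero])
    (fun X Y => by rw [hdist, coshDist_comm, hdist])
    hdist_triangle isOpen_iff_hdist
    (fun X Y h => eq_of_coshDist_eq_one
      ((Real.arcosh_eq_zero_iff (one_le_coshDist X Y)).1 h))

/-- The matrices act by isometries. -/
instance : IsIsometricSMul (GL (Fin 2) ℂ) H3 :=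
  ⟨fun g => Isometry.of_dist_eq fun X Y => hdist_smul g X Y⟩

/-- The geodesic segment `[x, y]`: the points that lie metrically between `x` and `y`. -/
def geodesicSegment (x y : H3) : Set H3 := {z | dist x z + dist z y = dist x y}

/-- Geodesic convexity. -/
def IsConvex (K : Set H3) : Prop := ∀ x ∈ K, ∀ y ∈ K, geodesicSegment x y ⊆ K

end H3

/-! ### Surfaces in projective 3-space and their amoebas -/

/-- Complex projective 3-space, with homogeneous coordinates `(z₀ : z₁ : z₂ : z₃)`. -/
abbrev CP3 : Type := ℙ ℂ (Fin 4 → ℂ)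

/-- The matrix with rows `(z₀, z₁)` and `(z₂, z₃)`. -/
def toMatrix (v : Fin 4 → ℂ) : Matrix (Fin 2) (Fin 2) ℂ := !![v 0, v 1; v 2, v 3]

/-- The zero locus in `CP3` of a (homogeneous) polynomial. -/
def zeroLocus (F : MvPolynomial (Fin 4) ℂ) : Set CP3 := {p | MvPolynomial.eval p.rep F = 0}

/-- Algebraic surfaces: zero loci of non-zero homogeneous polynomials of positive degree. -/
def IsSurface (S : Set CP3) : Prop :=
  ∃ (d : ℕ) (F : MvPolynomial (Fin 4) ℂ), 0 < d ∧ F ≠ 0 ∧ F.IsHomogeneous d ∧ S = zeroLocus F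

/-- The quadric `Q = {z₀ z₃ - z₁ z₂ = 0}` of degenerate matrices. -/
def quadric : Set CP3 := {p | p.rep 0 * p.rep 3 - p.rep 1 * p.rep 2 = 0}

theorem det_rep_ne_zero {p : CP3} (hp : p ∉ quadric) : (toMatrix p.rep).det ≠ 0 := by
  rw [toMatrix, Matrix.det_fin_two_of]; exact hp

/-- The map `ϰ` from the complement of the quadric, the group `PSL₂(ℂ)` of orientation-preserving
isometries, to hyperbolic space: it takes an isometry `p` to the image `p(0)` of the origin. -/
noncomputable def kappa (p : CP3) (hp : p ∉ quadric) : H3 :=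
  Matrix.GeneralLinearGroup.mkOfDetNeZero (toMatrix p.rep) (det_rep_ne_zero hp) • H3.origin

/-- The hyperbolic amoeba `ϰ(S \ Q)` of `S`. -/
def amoeba (S : Set CP3) : Set H3 := {x | ∃ (p : CP3) (hp : p ∉ quadric), p ∈ S ∧ kappa p hp = x}

/-- The value of `ϰ` does not depend on the choice of homogeneous coordinates. -/
theorem kappa_mk (v : Fin 4 → ℂ) (hv : v ≠ 0)
    (hp : Projectivization.mk ℂ v hv ∉ quadric) (hd : (toMatrix v).det ≠ 0) :
    kappa (Projectivization.mk ℂ v hv) hp =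
      Matrix.GeneralLinearGroup.mkOfDetNeZero (toMatrix v) hd • H3.origin := by
  obtain ⟨c, hc⟩ := Projectivization.exists_smul_eq_mk_rep ℂ v hv
  refine H3.ext ?_
  rw [kappa, H3.mat_smul, H3.mat_smul]
  change (‖(toMatrix (Projectivization.mk ℂ v hv).rep).det‖⁻¹ : ℝ) •
      (toMatrix (Projectivization.mk ℂ v hv).rep * 1 *
        (toMatrix (Projectivization.mk ℂ v hv).rep)ᴴ) =
    (‖(toMatrix v).det‖⁻¹ : ℝ) • (toMatrix v * 1 * (toMatrix v)ᴴ)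
  have e : toMatrix (Projectivization.mk ℂ v hv).rep = (c : ℂ) • toMatrix v := by
    rw [← hc]
    ext i j
    fin_cases i <;> fin_cases j <;> simp [toMatrix, Units.smul_def]
  have hc0 : ‖(c : ℂ)‖ ≠ 0 := norm_ne_zero_iff.2 c.ne_zero
  have hcc : (c : ℂ) * star (c : ℂ) = ((‖(c : ℂ)‖ ^ 2 : ℝ) : ℂ) := by
    push_cast; rw [← Complex.mul_conj']; rfl
  rw [e, Matrix.det_smul, norm_mul, norm_pow, Matrix.conjTranspose_smul, Matrix.mul_one,
    Matrix.mul_one, Matrix.smul_mul, Matrix.mul_smul, smul_smul, hcc, Fintype.card_fin]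
  ext i j
  simp only [Matrix.smul_apply, smul_eq_mul, Complex.real_smul]
  rw [← mul_assoc, ← Complex.ofReal_mul]
  congr 2
  field_simp

end HyperbolicAmoeba

namespace HyperbolicAmoeba

/-! A point `M Mᴴ` of hyperbolic space has the coset `M U(2)` as its fibre, so it lies outside the
amoeba exactly when `F` has no zero on `M U(2)`. Convexity then follows by counting zeros of
one-variable polynomials.

Let `P` be an orthogonal projection of rank one and `V` a unitary matrix. The restriction `p(w) =
F(M (w P + (1 - P)) V)` has no zero on `|w| = 1`, because `w P + (1 - P)` is unitary there. Rotating
`P` continuously into `1 - P` keeps the number of zeros in the unit disc, while exchanging `P` and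
`1 - P` replaces `p(w)` by `w^d p(1/w)`. Zeros of `p` inside and outside the disc, with infinity
included, are therefore equally many: exactly `d / 2` lie inside (`two_mul_countP_restrictLine`). In
particular, the complement is empty if `d` is odd.

Moving along a geodesic replaces `M` by `M diag(eᵗ, e⁻ᵗ)`, which up to a factor dilates `w` by
`e^{2t}`. If both endpoints avoid the amoeba, `p` has `d / 2` zeros in the disc of radius `1` and
also in that of radius `e^{2t}`, hence none in between; evaluation at `w = e^{2s}` shows that
intermediate points avoid the amoeba (`eval_translation_ne_zero`). Isometries carry any two points
to the axis. Openness is compactness of `U(2)` in disguise: matrices `A` with `A Aᴴ` bounded are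
bounded. -/

/-! ### Counting zeros of polynomials in discs -/

open Polynomial in
/-- The integral of `w p'(w) / p(w)` in the angular coordinate of the circle `|w| = r`: `2 π` times
the number of zeros in the disc. -/
noncomputable def logDerivIntegral (p : ℂ[X]) (r : ℝ) : ℂ :=
  ∫ θ in (0 : ℝ)..2 * Real.pi,
    circleMap 0 r θ * (p.derivative.eval (circleMap 0 r θ) / p.eval (circleMap 0 r θ))

theorem circleIntegral_inv_sub_of_lt {a : ℂ} {r : ℝ} (hr : 0 < r) (ha : r < ‖a‖) :
    ∮ z in C(0, r), (z - a)⁻¹ = 0 := by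
  refine DiffContOnCl.circleIntegral_eq_zero hr.le (DifferentiableOn.diffContOnCl ?_)
  intro z hz
  have hz' := Metric.closure_ball_subset_closedBall hz
  rw [mem_closedBall_zero_iff] at hz'
  have : z - a ≠ 0 := by
    rw [sub_ne_zero]; rintro rfl; linarith
  fun_prop (disch := assumption)

theorem circleIntegrable_inv_sub {a : ℂ} {r : ℝ} (hr : 0 < r) (ha : ‖a‖ ≠ r) :
    CircleIntegrable (fun z => (z - a)⁻¹) 0 r := by
  refine ContinuousOn.circleIntegrable hr.le (ContinuousOn.inv₀ (by fun_prop) ?_)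
  intro z hz h
  rw [mem_sphere_zero_iff_norm] at hz
  rw [sub_eq_zero.1 h] at hz
  exact ha hz

theorem circleIntegral_multiset_sum (s : Multiset ℂ) {r : ℝ} (hr : 0 < r)
    (hs : ∀ a ∈ s, ‖a‖ ≠ r) :
    CircleIntegrable (fun z => (s.map fun a => (z - a)⁻¹).sum) 0 r ∧
      ∮ z in C(0, r), (s.map fun a => (z - a)⁻¹).sum =
        2 * Real.pi * Complex.I * (s.countP fun a => ‖a‖ < r : ℕ) := by
  induction s using Multiset.induction with
  | empty => simp [circleIntegral]
  | cons a s ih =>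
    obtain ⟨h1, h2⟩ := ih fun b hb => hs b (Multiset.mem_cons_of_mem hb)
    have ha := hs a (Multiset.mem_cons_self a s)
    have h3 := circleIntegrable_inv_sub hr ha
    simp only [Multiset.map_cons, Multiset.sum_cons]
    refine ⟨h3.add h1, ?_⟩
    rw [circleIntegral.integral_add h3 h1, h2, Multiset.countP_cons]
    split_ifs with hlt
    · rw [circleIntegral.integral_sub_inv_of_mem_ball (by simpa using hlt)]
      push_cast; ring
    · rw [circleIntegral_inv_sub_of_lt hr (lt_of_le_of_ne (not_lt.1 hlt) (Ne.symm ha))]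
      simp

/-- The argument principle: over ℂ, `p'/p` is the sum of `1 / (z - a)` over the roots with
multiplicity, and each root inside the circle contributes `2πi`. -/
theorem logDerivIntegral_eq_countP (p : Polynomial ℂ) {r : ℝ} (hr : 0 < r)
    (hp : ∀ z : ℂ, ‖z‖ = r → p.eval z ≠ 0) :
    logDerivIntegral p r = 2 * Real.pi * (p.roots.countP fun a => ‖a‖ < r : ℕ) := by
  have h := (circleIntegral_multiset_sum p.roots hr fun a ha hra =>
    hp a hra (Polynomial.isRoot_of_mem_roots ha)).2
  have e : ∮ z in C(0, r), (p.roots.map fun a => (z - a)⁻¹).sum =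
      Complex.I * logDerivIntegral p r := by
    rw [circleIntegral, logDerivIntegral, ← intervalIntegral.integral_const_mul]
    refine intervalIntegral.integral_congr fun θ _ => ?_
    have hne := hp (circleMap 0 r θ) (by simp [abs_of_pos hr])
    simp only [deriv_circleMap, smul_eq_mul]
    rw [(IsAlgClosed.splits p).eval_derivative_div_eval_of_ne_zero hne]
    simp only [one_div]
    ring
  rw [e] at h
  refine mul_left_cancel₀ Complex.I_ne_zero ?_
  rw [h]; ring

/-- The number of zeros in a disc is constant in a continuous family of polynomials without zeros
on the boundary circle. -/
theorem countP_roots_eq_of_continuous {T : Type*} [TopologicalSpace T] [PreconnectedSpace T]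
    (p : T → Polynomial ℂ) {r : ℝ} (hr : 0 < r)
    (h0 : Continuous fun x : T × ℂ => (p x.1).eval x.2)
    (h1 : Continuous fun x : T × ℂ => (p x.1).derivative.eval x.2)
    (hp : ∀ t, ∀ z : ℂ, ‖z‖ = r → (p t).eval z ≠ 0) (s t : T) :
    ((p s).roots.countP fun a => ‖a‖ < r) = (p t).roots.countP fun a => ‖a‖ < r := by
  have hc : Continuous fun t => logDerivIntegral (p t) r := by
    refine intervalIntegral.continuous_parametric_intervalIntegral_of_continuous' ?_ _ _
    have hm : Continuous fun x : T × ℝ => (x.1, circleMap 0 r x.2) :=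
      continuous_fst.prodMk ((continuous_circleMap 0 r).comp continuous_snd)
    refine (continuous_snd.comp hm).mul ((h1.comp hm).div (h0.comp hm) fun x => ?_)
    exact hp _ _ (by simp [abs_of_pos hr])
  -- The count is the integral divided by `2π`, hence continuous; being integer valued, it is
  -- constant on a preconnected space.
  have hn : Continuous fun t => ((p t).roots.countP fun a => ‖a‖ < r : ℕ) := by
    have h2 : Continuous fun t => (((p t).roots.countP fun a => ‖a‖ < r : ℕ) : ℝ) := by
      have h3 := Complex.continuous_re.comp (hc.div_const (2 * Real.pi : ℂ))
      convert h3 using 2 with t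
      have hpi : (2 * Real.pi : ℂ) ≠ 0 := by exact_mod_cast Real.two_pi_pos.ne'
      simp only [Function.comp_apply]
      rw [logDerivIntegral_eq_countP (p t) hr (hp t), mul_div_cancel_left₀ _ hpi,
        Complex.natCast_re]
    exact Nat.isClosedEmbedding_coe_real.isEmbedding.continuous_iff.2 h2
  exact isPreconnected_univ.constant hn.continuousOn (Set.mem_univ s) (Set.mem_univ t)

/-- If `q(w) = w^d p(1/w)` and `p` has no zero on the unit circle, then `p` and `q` have together
`d` zeros in the unit disc. -/
theorem countP_roots_add_of_inversion {p q : Polynomial ℂ} {d : ℕ}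
    (hpq : ∀ w : ℂ, w ≠ 0 → q.eval w = w ^ d * p.eval w⁻¹)
    (hp : ∀ z : ℂ, ‖z‖ = 1 → p.eval z ≠ 0) :
    ((p.roots.countP fun a => ‖a‖ < 1) + q.roots.countP fun a => ‖a‖ < 1) = d := by
  have hq : ∀ z : ℂ, ‖z‖ = 1 → q.eval z ≠ 0 := by
    intro z hz
    have hz0 : z ≠ 0 := by rintro rfl; simp at hz
    rw [hpq z hz0]
    exact mul_ne_zero (pow_ne_zero _ hz0) (hp _ (by rw [norm_inv, hz, inv_one]))
  -- The logarithmic derivative of `w ^ d * p(1/w)`, multiplied by `w`.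
  have key : ∀ z : ℂ, ‖z‖ = 1 → z * (q.derivative.eval z / q.eval z) =
      d - z⁻¹ * (p.derivative.eval z⁻¹ / p.eval z⁻¹) := by
    intro z hz
    have hz0 : z ≠ 0 := by rintro rfl; simp at hz
    have h1 : HasDerivAt (fun w : ℂ => w ^ d * p.eval w⁻¹)
        (d * z ^ (d - 1) * p.eval z⁻¹ +
          z ^ d * (p.derivative.eval z⁻¹ * (-(z ^ 2)⁻¹))) z :=
      (hasDerivAt_pow d z).mul ((p.hasDerivAt z⁻¹).comp z (hasDerivAt_inv hz0))
    have h2 : HasDerivAt (fun w : ℂ => w ^ d * p.eval w⁻¹) (q.derivative.eval z) z := by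
      refine (q.hasDerivAt z).congr_of_eventuallyEq ?_
      filter_upwards [isOpen_ne.mem_nhds hz0] with w hw
      exact (hpq w hw).symm
    have hpz := hp z⁻¹ (by rw [norm_inv, hz, inv_one])
    rw [h2.unique h1, hpq z hz0]
    generalize p.eval z⁻¹ = u at hpz
    generalize p.derivative.eval z⁻¹ = v
    rcases d with _ | d
    · simp; field_simp
    · rw [Nat.add_sub_cancel]
      field_simp
      ring
  have hJ : logDerivIntegral q 1 = 2 * Real.pi * d - logDerivIntegral p 1 := by
    have hc : Continuous fun θ : ℝ => circleMap 0 1 θ *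
        (p.derivative.eval (circleMap 0 1 θ) / p.eval (circleMap 0 1 θ)) := by
      have := continuous_circleMap 0 1
      refine this.mul (Continuous.div ?_ ?_ fun θ => hp _ (by simp))
      · exact (Polynomial.continuous _).comp this
      · exact (Polynomial.continuous _).comp this
    set f : ℝ → ℂ := fun θ => circleMap 0 1 θ *
        (p.derivative.eval (circleMap 0 1 θ) / p.eval (circleMap 0 1 θ)) with hf
    -- On the unit circle `z⁻¹` is the point of angle `-θ`; periodicity brings the reflected
    -- interval back to `[0, 2π]`.
    have hper : Function.Periodic f (2 * Real.pi) := fun θ => by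
      simp only [hf, periodic_circleMap 0 1 θ]
    have e : logDerivIntegral q 1 = ∫ θ in (0 : ℝ)..2 * Real.pi, ((d : ℂ) - f (-θ)) := by
      refine intervalIntegral.integral_congr fun θ _ => ?_
      rw [key _ (by simp), circleMap_zero_inv, inv_one]
    have e' : ∫ θ in (-(2 * Real.pi))..0, f θ = ∫ θ in (0 : ℝ)..2 * Real.pi, f θ := by
      have := hper.intervalIntegral_add_eq (-(2 * Real.pi)) 0
      simpa using this
    have hi : IntervalIntegrable (fun θ => f (-θ)) MeasureTheory.volume 0 (2 * Real.pi) :=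
      (hc.comp continuous_neg).intervalIntegrable _ _
    rw [e, intervalIntegral.integral_sub intervalIntegrable_const hi, intervalIntegral.integral_comp_neg,
      neg_zero, e', intervalIntegral.integral_const]
    simp [logDerivIntegral, hf]
  rw [logDerivIntegral_eq_countP q one_pos hq, logDerivIntegral_eq_countP p one_pos hp] at hJ
  have hpi : (2 * Real.pi : ℂ) ≠ 0 := by exact_mod_cast Real.two_pi_pos.ne'
  have : (2 * Real.pi : ℂ) * ((p.roots.countP fun a => ‖a‖ < 1 : ℕ) +
      (q.roots.countP fun a => ‖a‖ < 1 : ℕ)) = 2 * Real.pi * d := by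
    linear_combination hJ
  exact_mod_cast mul_left_cancel₀ hpi this

/-- A polynomial with equally many zeros in two concentric discs has no zero between them. -/
theorem eval_ne_zero_of_countP_eq {p : Polynomial ℂ} (hp : p ≠ 0) {r R : ℝ} (hrR : r ≤ R)
    (h : (p.roots.countP fun a => ‖a‖ < r) = p.roots.countP fun a => ‖a‖ < R) {z : ℂ}
    (hr : r ≤ ‖z‖) (hR : ‖z‖ < R) : p.eval z ≠ 0 := by
  intro hz
  have hmem : z ∈ p.roots := (Polynomial.mem_roots hp).2 hz
  -- Splitting off the root `z`, which only the larger disc counts, makes the two counts differ by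
  -- at least one.
  obtain ⟨s, hs⟩ := Multiset.exists_cons_of_mem hmem
  rw [hs, Multiset.countP_cons, Multiset.countP_cons, if_neg (not_lt.2 hr), if_pos hR] at h
  have : (s.countP fun a => ‖a‖ < r) ≤ s.countP fun a => ‖a‖ < R := by
    rw [Multiset.countP_eq_card_filter, Multiset.countP_eq_card_filter]
    exact Multiset.card_le_card (Multiset.monotone_filter_right s fun a ha => ha.trans_le hrR)
  omega

/-! ### Homogeneous polynomials on matrices and their restrictions to lines -/

/-- The coordinate vector of a matrix, inverse to `toMatrix`. -/
def toVec (A : Matrix (Fin 2) (Fin 2) ℂ) : Fin 4 → ℂ := ![A 0 0, A 0 1, A 1 0, A 1 1]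

theorem toMatrix_toVec (A : Matrix (Fin 2) (Fin 2) ℂ) : toMatrix (toVec A) = A := by
  ext i j; fin_cases i <;> fin_cases j <;> simp [toMatrix, toVec]

theorem toVec_toMatrix (v : Fin 4 → ℂ) : toVec (toMatrix v) = v := by
  ext i; fin_cases i <;> simp [toMatrix, toVec]

theorem toVec_add (A B : Matrix (Fin 2) (Fin 2) ℂ) : toVec (A + B) = toVec A + toVec B := by
  ext i; fin_cases i <;> simp [toVec]

theorem toVec_smul (c : ℂ) (A : Matrix (Fin 2) (Fin 2) ℂ) : toVec (c • A) = c • toVec A := by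
  ext i; fin_cases i <;> simp [toVec]

theorem continuous_toVec : Continuous toVec := by
  refine continuous_pi fun i => ?_
  fin_cases i <;> simp only [toVec] <;> exact continuous_apply_apply _ _

theorem eval_smul_of_isHomogeneous {σ : Type*} [Fintype σ] {F : MvPolynomial σ ℂ} {d : ℕ}
    (hF : F.IsHomogeneous d) (c : ℂ) (v : σ → ℂ) :
    MvPolynomial.eval (c • v) F = c ^ d * MvPolynomial.eval v F := by
  rw [MvPolynomial.eval_eq', MvPolynomial.eval_eq', Finset.mul_sum]
  refine Finset.sum_congr rfl fun m hm => ?_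
  have h : ∑ i, m i = d := by
    rw [← Finsupp.degree_eq_sum, Finsupp.degree_eq_weight_one]
    exact hF (MvPolynomial.mem_support_iff.1 hm)
  simp only [Pi.smul_apply, smul_eq_mul, mul_pow, Finset.prod_mul_distrib]
  rw [Finset.prod_pow_eq_pow_sum, h]
  ring

theorem eval_toVec_smul {F : MvPolynomial (Fin 4) ℂ} {d : ℕ}
    (hF : F.IsHomogeneous d) (c : ℂ) (A : Matrix (Fin 2) (Fin 2) ℂ) :
    MvPolynomial.eval (toVec (c • A)) F = c ^ d * MvPolynomial.eval (toVec A) F := by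
  rw [toVec_smul, eval_smul_of_isHomogeneous hF]

/-- The restriction of `F` to the affine line `w ↦ w A + B`. -/
noncomputable def restrictLine (F : MvPolynomial (Fin 4) ℂ) (A B : Matrix (Fin 2) (Fin 2) ℂ) :
    Polynomial ℂ :=
  MvPolynomial.aeval
    (fun i => Polynomial.C (toVec A i) * Polynomial.X + Polynomial.C (toVec B i)) F

theorem eval_restrictLine (F : MvPolynomial (Fin 4) ℂ) (A B : Matrix (Fin 2) (Fin 2) ℂ) (w : ℂ) :
    (restrictLine F A B).eval w = MvPolynomial.eval (toVec (w • A + B)) F := by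
  rw [restrictLine, toVec_add, toVec_smul]
  induction F using MvPolynomial.induction_on with
  | C a => simp
  | add p q hp hq => simp [hp, hq]
  | mul_X p i hp => simp [hp, mul_comm w]

/-- Joint continuity in the parameter and in `w` is all that the zero count needs, so the degree of
the restriction may drop along the family. -/
theorem continuous_restrictLine {T : Type*} [TopologicalSpace T] (F : MvPolynomial (Fin 4) ℂ)
    {A B : T → Matrix (Fin 2) (Fin 2) ℂ} (hA : Continuous A) (hB : Continuous B) :
    (Continuous fun x : T × ℂ => (restrictLine F (A x.1) (B x.1)).eval x.2) ∧
      Continuous fun x : T × ℂ => (restrictLine F (A x.1) (B x.1)).derivative.eval x.2 := by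
  have hA' : ∀ i, Continuous fun x : T × ℂ => toVec (A x.1) i := fun i =>
    (continuous_apply i).comp (continuous_toVec.comp (hA.comp continuous_fst))
  have hB' : ∀ i, Continuous fun x : T × ℂ => toVec (B x.1) i := fun i =>
    (continuous_apply i).comp (continuous_toVec.comp (hB.comp continuous_fst))
  unfold restrictLine
  induction F using MvPolynomial.induction_on with
  | C a => simp [continuous_const]
  | add p q hp hq =>
    simp only [map_add, Polynomial.eval_add]
    exact ⟨hp.1.add hq.1, hp.2.add hq.2⟩
  | mul_X p i hp =>
    simp only [map_mul, MvPolynomial.aeval_X, Polynomial.derivative_mul, Polynomial.derivative_add,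
      Polynomial.derivative_C, Polynomial.derivative_X, Polynomial.eval_add, Polynomial.eval_mul,
      Polynomial.eval_C, Polynomial.eval_X, mul_one, zero_mul, zero_add, add_zero]
    have hl := ((hA' i).mul continuous_snd).add (hB' i)
    exact ⟨hp.1.mul hl, (hp.2.mul hl).add (hp.1.mul (hA' i))⟩

/-! ### Rotating a projection: half of the zeros lie in the unit disc -/

/-- The orthogonal projection onto the line spanned by `(cos θ, sin θ)`. -/
noncomputable def lineProj (θ : ℝ) : Matrix (Fin 2) (Fin 2) ℂ :=
  !![((Real.cos θ * Real.cos θ : ℝ) : ℂ), ((Real.cos θ * Real.sin θ : ℝ) : ℂ);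
    ((Real.cos θ * Real.sin θ : ℝ) : ℂ), ((Real.sin θ * Real.sin θ : ℝ) : ℂ)]

theorem lineProj_zero : lineProj 0 = !![1, 0; 0, 0] := by
  simp [lineProj]

theorem one_sub_lineProj_zero : 1 - lineProj 0 = !![0, 0; 0, 1] := by
  rw [lineProj_zero, Matrix.one_fin_two]
  ext i j; fin_cases i <;> fin_cases j <;> simp

/-- A quarter turn exchanges the line with its orthogonal complement, so `lineProj` is a path from a
projection to its complementary one. -/
theorem lineProj_pi_div_two : lineProj (Real.pi / 2) = 1 - lineProj 0 := by
  rw [one_sub_lineProj_zero]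
  simp [lineProj]

theorem continuous_lineProj : Continuous lineProj := by
  refine continuous_matrix fun i j => ?_
  fin_cases i <;> fin_cases j <;> simp [lineProj] <;> fun_prop

theorem lineProj_mul_self (θ : ℝ) : lineProj θ * lineProj θ = lineProj θ := by
  have h := Real.sin_sq_add_cos_sq θ
  ext i j
  fin_cases i <;> fin_cases j <;> simp only [lineProj, Matrix.mul_apply, Fin.sum_univ_two] <;>
    simp <;> norm_cast
  · linear_combination (Real.cos θ) ^ 2 * h
  · linear_combination (Real.cos θ * Real.sin θ) * h
  · linear_combination (Real.cos θ * Real.sin θ) * h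
  · linear_combination (Real.sin θ) ^ 2 * h

theorem conjTranspose_lineProj (θ : ℝ) : (lineProj θ)ᴴ = lineProj θ := by
  ext i j
  fin_cases i <;> fin_cases j <;> simp only [lineProj, Matrix.conjTranspose_apply] <;>
    exact Complex.conj_ofReal _

/-- The matrix is multiplication by `w` on a line and the identity on the orthogonal complement. -/
theorem smul_lineProj_add_mem_unitaryGroup (θ : ℝ) {w : ℂ} (hw : ‖w‖ = 1) :
    w • lineProj θ + (1 - lineProj θ) ∈ Matrix.unitaryGroup (Fin 2) ℂ := by
  rw [Matrix.mem_unitaryGroup_iff, Matrix.star_eq_conjTranspose, Matrix.conjTranspose_add,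
    Matrix.conjTranspose_sub, Matrix.conjTranspose_smul, conjTranspose_lineProj,
    Matrix.conjTranspose_one]
  have hP := lineProj_mul_self θ
  have hww : w * star w = 1 := by
    change w * (starRingEnd ℂ) w = 1
    rw [Complex.mul_conj', hw]; simp
  simp only [add_mul, mul_add, mul_sub, sub_mul, Matrix.smul_mul, Matrix.mul_smul, mul_one,
    one_mul, hP, smul_smul]
  rw [mul_comm] at hww
  simp only [hww, one_smul]
  abel

/-- The rotation by `π / 2` preserves the count and ends at the polynomial `w^d p(1/w)`, whose count
is complementary to that of `p`. -/
theorem two_mul_countP_restrictLine {F : MvPolynomial (Fin 4) ℂ} {d : ℕ}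
    (hF : F.IsHomogeneous d) {M : Matrix (Fin 2) (Fin 2) ℂ}
    (hM : ∀ V ∈ Matrix.unitaryGroup (Fin 2) ℂ, MvPolynomial.eval (toVec (M * V)) F ≠ 0)
    {V : Matrix (Fin 2) (Fin 2) ℂ} (hV : V ∈ Matrix.unitaryGroup (Fin 2) ℂ) :
    2 * ((restrictLine F (M * lineProj 0 * V) (M * (1 - lineProj 0) * V)).roots.countP
      fun a => ‖a‖ < 1) = d := by
  have hA : Continuous fun θ => M * lineProj θ * V := by
    have := continuous_lineProj; fun_prop
  have hB : Continuous fun θ => M * (1 - lineProj θ) * V := by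
    have := continuous_lineProj; fun_prop
  have hne : ∀ θ : ℝ, ∀ z : ℂ, ‖z‖ = 1 →
      (restrictLine F (M * lineProj θ * V) (M * (1 - lineProj θ) * V)).eval z ≠ 0 := by
    intro θ z hz
    rw [eval_restrictLine]
    have e : z • (M * lineProj θ * V) + M * (1 - lineProj θ) * V =
        M * ((z • lineProj θ + (1 - lineProj θ)) * V) := by
      rw [← Matrix.mul_assoc, Matrix.mul_add, Matrix.add_mul, Matrix.mul_smul, Matrix.smul_mul]
    rw [e]
    exact hM _ (mul_mem (smul_lineProj_add_mem_unitaryGroup θ hz) hV)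
  obtain ⟨h0, h1⟩ := continuous_restrictLine F hA hB
  have hcount := countP_roots_eq_of_continuous
    (fun θ => restrictLine F (M * lineProj θ * V) (M * (1 - lineProj θ) * V)) one_pos h0 h1 hne 0 (Real.pi / 2)
  have hp := hne 0
  simp only [lineProj_pi_div_two, sub_sub_cancel] at hcount
  have hsum := countP_roots_add_of_inversion (d := d)
    (q := restrictLine F (M * (1 - lineProj 0) * V) (M * lineProj 0 * V)) (fun w hw => by
      rw [eval_restrictLine, eval_restrictLine, ← eval_toVec_smul hF, smul_add, smul_smul,
        mul_inv_cancel₀ hw, one_smul, add_comm]) hp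
  rw [← hcount] at hsum
  rw [two_mul, hsum]

/-- The substitution `w ↦ a w` carries the unit circle to the circle of radius `a`, and a constant
factor cancels in the logarithmic derivative. -/
theorem logDerivIntegral_of_eval_eq {p q : Polynomial ℂ} {a : ℝ} {c : ℂ} (hc : c ≠ 0)
    (h : ∀ w, q.eval w = c * p.eval (a * w)) : logDerivIntegral q 1 = logDerivIntegral p a := by
  have e : q = Polynomial.C c * p.comp (Polynomial.C (a : ℂ) * Polynomial.X) :=
    Polynomial.funext fun w => by simp [h]
  refine intervalIntegral.integral_congr fun θ _ => ?_
  have hm : circleMap 0 a θ = a * circleMap 0 1 θ := by simp [circleMap]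
  simp only [e, hm, Polynomial.derivative_mul, Polynomial.derivative_comp, Polynomial.eval_mul,
    Polynomial.eval_comp, Polynomial.eval_C, Polynomial.eval_X,
    Polynomial.derivative_C, Polynomial.derivative_X,
    zero_mul, zero_add, mul_one]
  rw [mul_div_mul_left _ _ hc]
  ring

/-! ### Translation along a geodesic as dilation of the variable -/

/-- The hyperbolic translation `diag(eᵗ, e⁻ᵗ)`. -/
noncomputable def translation (t : ℝ) : Matrix (Fin 2) (Fin 2) ℂ :=
  !![((Real.exp t : ℝ) : ℂ), 0; 0, ((Real.exp (-t) : ℝ) : ℂ)]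

/-- The translation scales the two coordinate axes by `eᵗ` and `e⁻ᵗ`; pulling out `e⁻ᵗ` leaves the
factor `e^{2t}` on `w`. -/
theorem smul_add_eq_translation_mul (M V : Matrix (Fin 2) (Fin 2) ℂ) (t : ℝ) (w : ℂ) :
    w • (M * translation t * lineProj 0 * V) + M * translation t * (1 - lineProj 0) * V =
      ((Real.exp (-t) : ℝ) : ℂ) • ((((Real.exp (2 * t) : ℝ) : ℂ) * w) • (M * lineProj 0 * V) +
        M * (1 - lineProj 0) * V) := by
  have h1 : translation t * lineProj 0 = ((Real.exp t : ℝ) : ℂ) • lineProj 0 := by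
    rw [lineProj_zero]
    ext i j; fin_cases i <;> fin_cases j <;> simp [translation]
  have h2 : translation t * (1 - lineProj 0) = ((Real.exp (-t) : ℝ) : ℂ) • (1 - lineProj 0) := by
    rw [one_sub_lineProj_zero]
    ext i j; fin_cases i <;> fin_cases j <;> simp [translation]
  have h3 : ((Real.exp (-t) : ℝ) : ℂ) * (((Real.exp (2 * t) : ℝ) : ℂ) * w) =
      w * ((Real.exp t : ℝ) : ℂ) := by
    rw [← mul_assoc, ← Complex.ofReal_mul, ← Real.exp_add, mul_comm]; ring_nf
  rw [Matrix.mul_assoc M _ (lineProj 0), h1, Matrix.mul_assoc M _ (1 - lineProj 0), h2, smul_add, smul_smul, h3, Matrix.mul_smul,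
    Matrix.smul_mul, Matrix.mul_smul, Matrix.smul_mul, smul_smul]

/-- A homogeneous polynomial without zeros on the unitary matrices times `M` and times
`M diag(eᵗ, e⁻ᵗ)` has no zeros on the unitary matrices times `M diag(eˢ, e⁻ˢ)` for `s` between
`0` and `t`. -/
theorem eval_translation_ne_zero {F : MvPolynomial (Fin 4) ℂ} {d : ℕ}
    (hF : F.IsHomogeneous d) {M : Matrix (Fin 2) (Fin 2) ℂ} {s t : ℝ}
    (h0 : ∀ V ∈ Matrix.unitaryGroup (Fin 2) ℂ, MvPolynomial.eval (toVec (M * V)) F ≠ 0)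
    (ht : ∀ V ∈ Matrix.unitaryGroup (Fin 2) ℂ,
      MvPolynomial.eval (toVec (M * translation t * V)) F ≠ 0)
    (hs : s ∈ Set.uIcc 0 t) {V : Matrix (Fin 2) (Fin 2) ℂ}
    (hV : V ∈ Matrix.unitaryGroup (Fin 2) ℂ) :
    MvPolynomial.eval (toVec (M * translation s * V)) F ≠ 0 := by
  set p := restrictLine F (M * lineProj 0 * V) (M * (1 - lineProj 0) * V) with hp
  set q := restrictLine F (M * translation t * lineProj 0 * V)
    (M * translation t * (1 - lineProj 0) * V) with hq
  have hexp : ∀ r : ℝ, ((Real.exp (-r) : ℝ) : ℂ) ^ d ≠ 0 := fun r =>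
    pow_ne_zero _ (by exact_mod_cast (Real.exp_pos _).ne')
  have hpq : ∀ w, q.eval w =
      ((Real.exp (-t) : ℝ) : ℂ) ^ d * p.eval (((Real.exp (2 * t) : ℝ) : ℂ) * w) := fun w => by
    rw [hp, hq, eval_restrictLine, eval_restrictLine, smul_add_eq_translation_mul,
      eval_toVec_smul hF]
  have hsum : lineProj 0 + (1 - lineProj 0) = 1 := add_sub_cancel _ _
  -- The case `w = 1`, where the two complementary projections add up to the identity.
  have hone : ∀ r : ℝ, MvPolynomial.eval (toVec (M * translation r * V)) F =
      ((Real.exp (-r) : ℝ) : ℂ) ^ d * p.eval ((Real.exp (2 * r) : ℝ) : ℂ) := fun r => by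
    have := smul_add_eq_translation_mul M V r 1
    rw [one_smul, ← Matrix.add_mul, ← Matrix.mul_add, hsum, Matrix.mul_one, mul_one] at this
    rw [this, eval_toVec_smul hF, hp, eval_restrictLine]
  have hcirc : ∀ N : Matrix (Fin 2) (Fin 2) ℂ,
      (∀ V ∈ Matrix.unitaryGroup (Fin 2) ℂ, MvPolynomial.eval (toVec (N * V)) F ≠ 0) →
      ∀ z : ℂ, ‖z‖ = 1 →
        (restrictLine F (N * lineProj 0 * V) (N * (1 - lineProj 0) * V)).eval z ≠ 0 := by
    intro N hN z hz
    have hu := smul_lineProj_add_mem_unitaryGroup 0 hz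
    rw [eval_restrictLine]
    have := hN _ (mul_mem hu hV)
    rwa [← Matrix.mul_assoc, Matrix.mul_add, Matrix.add_mul, Matrix.mul_smul,
      Matrix.smul_mul] at this
  have hp1 := hcirc M h0
  have hq1 := hcirc _ ht
  rw [← hp] at hp1
  rw [← hq] at hq1
  have hpt : ∀ z : ℂ, ‖z‖ = Real.exp (2 * t) → p.eval z ≠ 0 := by
    intro z hz
    have he : ((Real.exp (2 * t) : ℝ) : ℂ) ≠ 0 := by exact_mod_cast (Real.exp_pos _).ne'
    have := hq1 (((Real.exp (2 * t) : ℝ) : ℂ)⁻¹ * z) (by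
      rw [norm_mul, norm_inv, hz, Complex.norm_real, Real.norm_of_nonneg (Real.exp_pos _).le,
        inv_mul_cancel₀ (Real.exp_pos _).ne'])
    rw [hpq, mul_inv_cancel_left₀ he] at this
    exact right_ne_zero_of_mul this
  -- Both counts are `d / 2`: the first for `M`, the second for `M * translation t`, after rescaling
  -- the unit disc of `q` to the disc of radius `e^{2t}` for `p`.
  have hcount : (p.roots.countP fun a => ‖a‖ < 1) =
      p.roots.countP fun a => ‖a‖ < Real.exp (2 * t) := by
    have e1 := two_mul_countP_restrictLine hF h0 hV
    have e2 := two_mul_countP_restrictLine hF ht hV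
    rw [← hp] at e1
    rw [← hq] at e2
    have e3 := logDerivIntegral_of_eval_eq (hexp t) hpq
    rw [logDerivIntegral_eq_countP q one_pos hq1,
      logDerivIntegral_eq_countP p (Real.exp_pos _) hpt] at e3
    have hpi : (2 * Real.pi : ℂ) ≠ 0 := by exact_mod_cast Real.two_pi_pos.ne'
    have e4 := Nat.cast_injective (mul_left_cancel₀ hpi e3)
    omega
  have hp0 : p ≠ 0 := by
    intro h; exact hp1 1 (by simp) (by rw [h, Polynomial.eval_zero])
  rw [hone]
  refine mul_ne_zero (hexp s) ?_
  have hnorm : ‖((Real.exp (2 * s) : ℝ) : ℂ)‖ = Real.exp (2 * s) := by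
    rw [Complex.norm_real, Real.norm_of_nonneg (Real.exp_pos _).le]
  -- Equal counts exclude zeros only up to the outer circle, which is not included; that circle is
  -- treated by the hypothesis at the corresponding endpoint.
  rcases Set.mem_uIcc.1 hs with ⟨hs0, hst⟩ | ⟨hst, hs0⟩
  · rcases hst.eq_or_lt with rfl | hlt
    · exact hpt _ hnorm
    · refine eval_ne_zero_of_countP_eq hp0 (Real.one_le_exp (by linarith)) hcount ?_ ?_ <;>
        rw [hnorm]
      · exact Real.one_le_exp (by linarith)
      · exact Real.exp_lt_exp.2 (by linarith)
  · rcases hs0.eq_or_lt with rfl | hlt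
    · exact hp1 _ (by rw [hnorm]; simp)
    · refine eval_ne_zero_of_countP_eq hp0 (Real.exp_le_one_iff.2 (by linarith)) hcount.symm
        ?_ ?_ <;> rw [hnorm]
      · exact Real.exp_le_exp.2 (by linarith)
      · exact Real.exp_lt_one_iff.2 (by linarith)

/-! ### Matrix description of the amoeba and its closedness -/

theorem norm_det_eq_one_of_mul_conjTranspose {A : Matrix (Fin 2) (Fin 2) ℂ} {X : H3}
    (hA : A * Aᴴ = X.mat) : ‖A.det‖ = 1 := by
  have h := congrArg Matrix.det hA
  rw [Matrix.det_mul, Matrix.det_conjTranspose, X.det_eq_one] at h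
  have h2 := congrArg norm h
  rw [norm_mul, norm_star, norm_one] at h2
  nlinarith [norm_nonneg A.det]

theorem exists_unit_smul_mul_conjTranspose (g : GL (Fin 2) ℂ) :
    ∃ c : ℝ, 0 < c ∧ ((c : ℂ) • g.1) * ((c : ℂ) • g.1)ᴴ = (g • H3.origin).mat := by
  have hg : g.1.det ≠ 0 := ((Matrix.isUnit_iff_isUnit_det _).1 g.isUnit).ne_zero
  have hn : 0 < ‖g.1.det‖⁻¹ := inv_pos.2 (norm_pos_iff.2 hg)
  -- The scalar enters `A Aᴴ` twice, hence the square root of the normalizing factor of the action.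
  refine ⟨√(‖g.1.det‖⁻¹), Real.sqrt_pos.2 hn, ?_⟩
  rw [H3.mat_smul, Matrix.conjTranspose_smul, Matrix.smul_mul, Matrix.mul_smul, smul_smul]
  have e : ((√(‖g.1.det‖⁻¹) : ℝ) : ℂ) * star ((√(‖g.1.det‖⁻¹) : ℝ) : ℂ) =
      ((‖g.1.det‖⁻¹ : ℝ) : ℂ) := by
    rw [show star ((√(‖g.1.det‖⁻¹) : ℝ) : ℂ) = ((√(‖g.1.det‖⁻¹) : ℝ) : ℂ) from
      Complex.conj_ofReal _, ← Complex.ofReal_mul, Real.mul_self_sqrt hn.le]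
  rw [e]
  change _ = (‖g.1.det‖⁻¹ : ℝ) • (g.1 * 1 * g.1ᴴ)
  rw [Matrix.mul_one]
  ext i j
  simp

/-- A point is in the amoeba of a surface iff it is `A A*` for a matrix `A` on the surface. -/
theorem mem_amoeba_zeroLocus_iff {F : MvPolynomial (Fin 4) ℂ} {d : ℕ} (hF : F.IsHomogeneous d)
    (X : H3) : X ∈ amoeba (zeroLocus F) ↔
      ∃ A : Matrix (Fin 2) (Fin 2) ℂ, A * Aᴴ = X.mat ∧ MvPolynomial.eval (toVec A) F = 0 := by
  constructor
  · rintro ⟨p, hp, hpF, rfl⟩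
    obtain ⟨c, -, hc⟩ := exists_unit_smul_mul_conjTranspose
      (Matrix.GeneralLinearGroup.mkOfDetNeZero (toMatrix p.rep) (det_rep_ne_zero hp))
    refine ⟨(c : ℂ) • toMatrix p.rep, hc, ?_⟩
    rw [eval_toVec_smul hF, toVec_toMatrix, show MvPolynomial.eval p.rep F = 0 from hpF, mul_zero]
  · rintro ⟨A, hA, hFA⟩
    have hn := norm_det_eq_one_of_mul_conjTranspose hA
    have hdet : A.det ≠ 0 := by
      intro h; rw [h, norm_zero] at hn; exact zero_ne_one hn
    have hd : (toMatrix (toVec A)).det ≠ 0 := by rwa [toMatrix_toVec]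
    have hv : toVec A ≠ 0 := by
      intro h; rw [h] at hd; exact hd (by simp [toMatrix])
    obtain ⟨c, hc⟩ := Projectivization.exists_smul_eq_mk_rep ℂ (toVec A) hv
    have hc' : (Projectivization.mk ℂ (toVec A) hv).rep = (c : ℂ) • toVec A := by
      rw [← hc, Units.smul_def]
    have hq : Projectivization.mk ℂ (toVec A) hv ∉ quadric := by
      intro h
      change (Projectivization.mk ℂ (toVec A) hv).rep 0 * _ - _ = 0 at h
      rw [hc'] at h
      refine hdet (mul_left_cancel₀ (pow_ne_zero 2 c.ne_zero) ?_)
      rw [mul_zero, ← h, Matrix.det_fin_two]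
      simp [toVec]
      ring
    refine ⟨_, hq, ?_, ?_⟩
    · change MvPolynomial.eval (Projectivization.mk ℂ (toVec A) hv).rep F = 0
      rw [hc', eval_smul_of_isHomogeneous hF, hFA, mul_zero]
    · rw [kappa_mk _ hv hq hd]
      refine H3.ext ?_
      rw [H3.mat_smul]
      change (‖(toMatrix (toVec A)).det‖⁻¹ : ℝ) •
        (toMatrix (toVec A) * 1 * (toMatrix (toVec A))ᴴ) = X.mat
      rw [toMatrix_toVec, hn, inv_one, one_smul, Matrix.mul_one, hA]

/-- A diagonal entry of `A Aᴴ` is the squared norm of a row of `A`. -/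
theorem norm_apply_sq_le_of_mul_conjTranspose {A B : Matrix (Fin 2) (Fin 2) ℂ}
    (hA : A * Aᴴ = B) (i j : Fin 2) : ‖A i j‖ ^ 2 ≤ ‖B i i‖ := by
  have h : ((∑ k, ‖A i k‖ ^ 2 : ℝ) : ℂ) = B i i := by
    rw [← hA, Matrix.mul_apply]
    push_cast
    refine Finset.sum_congr rfl fun k _ => ?_
    rw [Matrix.conjTranspose_apply, ← Complex.mul_conj']; rfl
  rw [← h, Complex.norm_real, Real.norm_of_nonneg (Finset.sum_nonneg fun k _ => sq_nonneg _)]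
  exact Finset.single_le_sum (f := fun k => ‖A i k‖ ^ 2) (fun k _ => sq_nonneg _)
    (Finset.mem_univ j)

/-- If `A n * (A n)ᴴ` converges, the matrices `A n` are bounded; a subsequential limit is a zero of
`F` lying over the limit point. -/
theorem isClosed_amoeba_zeroLocus {F : MvPolynomial (Fin 4) ℂ} {d : ℕ} (hF : F.IsHomogeneous d) :
    IsClosed (amoeba (zeroLocus F)) := by
  refine IsSeqClosed.isClosed fun X x hX hx => ?_
  choose A hA hFA using fun n => (mem_amoeba_zeroLocus_iff hF (X n)).1 (hX n)
  have hlim : Filter.Tendsto (fun n => (X n).mat) Filter.atTop (nhds x.mat) :=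
    (H3.continuous_mat.tendsto x).comp hx
  have hbdd : ∀ i : Fin 2, ∃ C : ℝ, ∀ n, ‖(X n).mat i i‖ ≤ C := fun i => by
    have h : Filter.Tendsto (fun n => (X n).mat i i) Filter.atTop (nhds (x.mat i i)) :=
      ((continuous_apply_apply i i).tendsto x.mat).comp hlim
    obtain ⟨C, hC⟩ := h.norm.bddAbove_range
    exact ⟨C, fun n => hC ⟨n, rfl⟩⟩
  choose C hC using hbdd
  set a : ℕ → Fin 2 → Fin 2 → ℂ := A with ha
  -- The radius `K + 1` serves because `x ^ 2 ≤ K` implies `x ≤ K + 1`.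
  have hball : ∀ n, a n ∈ Metric.closedBall (0 : Fin 2 → Fin 2 → ℂ) (|C 0| + |C 1| + 1) := by
    intro n
    rw [mem_closedBall_zero_iff]
    have hpos : 0 ≤ |C 0| + |C 1| + 1 := by positivity
    refine (pi_norm_le_iff_of_nonneg hpos).2 fun i => (pi_norm_le_iff_of_nonneg hpos).2 fun j => ?_
    have h1 : ‖a n i j‖ ^ 2 ≤ ‖(X n).mat i i‖ := norm_apply_sq_le_of_mul_conjTranspose (hA n) i j
    have h2 := hC i n
    have h3 : C i ≤ |C 0| + |C 1| := by
      fin_cases i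
      · exact (le_abs_self _).trans (le_add_of_nonneg_right (abs_nonneg _))
      · exact (le_abs_self _).trans (le_add_of_nonneg_left (abs_nonneg _))
    nlinarith [norm_nonneg (a n i j), abs_nonneg (C 0), abs_nonneg (C 1)]
  obtain ⟨B, -, φ, hφ, hB⟩ := tendsto_subseq_of_bounded Metric.isBounded_closedBall hball
  have hB' : Filter.Tendsto (fun n => A (φ n)) Filter.atTop
      (nhds (show Matrix (Fin 2) (Fin 2) ℂ from B)) := hB
  refine (mem_amoeba_zeroLocus_iff hF x).2 ⟨B, ?_, ?_⟩
  · have hc : Continuous fun M : Matrix (Fin 2) (Fin 2) ℂ => M * Mᴴ := by fun_prop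
    have h1 := (hc.tendsto _).comp hB'
    have h2 := hlim.comp hφ.tendsto_atTop
    refine tendsto_nhds_unique h1 (h2.congr fun n => ?_)
    exact (hA (φ n)).symm
  · have hc : Continuous fun M : Matrix (Fin 2) (Fin 2) ℂ => MvPolynomial.eval (toVec M) F :=
      (MvPolynomial.continuous_eval F).comp continuous_toVec
    have h1 := (hc.tendsto _).comp hB'
    refine tendsto_nhds_unique h1 (tendsto_const_nhds.congr fun n => ?_)
    exact (hFA (φ n)).symm

/-! ### Geodesics through the origin -/

theorem det_translation (t : ℝ) : (translation t).det = 1 := by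
  rw [translation, Matrix.det_fin_two_of, ← Complex.ofReal_mul, ← Real.exp_add]; simp

theorem conjTranspose_translation (t : ℝ) : (translation t)ᴴ = translation t := by
  ext i j
  fin_cases i <;> fin_cases j <;> simp only [translation, Matrix.conjTranspose_apply] <;>
    exact Complex.conj_ofReal _

theorem translation_add (s t : ℝ) : translation (s + t) = translation s * translation t := by
  ext i j
  fin_cases i <;> fin_cases j <;>
    simp [translation, Matrix.mul_apply, Complex.exp_add, mul_comm]

theorem translation_zero : translation 0 = 1 := by
  rw [Matrix.one_fin_two]; simp [translation]

/-- The point `diag(eᵗ, e⁻ᵗ)` at signed distance `t` from the origin on a fixed geodesic. -/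
noncomputable def axisPoint (t : ℝ) : H3 where
  mat := translation t
  posDef := by
    have h : translation t = translation (t / 2) * (translation (t / 2))ᴴ := by
      rw [conjTranspose_translation, ← translation_add, add_halves]
    rw [h]
    have hu : IsUnit (translation (t / 2)) := by
      rw [Matrix.isUnit_iff_isUnit_det, det_translation]; exact isUnit_one
    have := Matrix.PosDef.one.mul_mul_conjTranspose_same (B := translation (t / 2))
      (Matrix.vecMul_injective_iff_isUnit.2 hu)
    rwa [Matrix.mul_one] at this
  det_eq_one := det_translation t

theorem axisPoint_coord (t : ℝ) : (axisPoint t).mat =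
    !![((Real.exp t : ℝ) : ℂ), ⟨0, 0⟩; ⟨0, -0⟩, ((Real.exp (-t) : ℝ) : ℂ)] := by
  ext i j
  fin_cases i <;> fin_cases j <;> simp [axisPoint, translation, Complex.ext_iff]

theorem axisPoint_zero : axisPoint 0 = H3.origin := by
  refine H3.ext ?_
  exact translation_zero

theorem continuous_axisPoint : Continuous axisPoint := by
  refine continuous_induced_rng.2 (continuous_matrix fun i j => ?_)
  fin_cases i <;> fin_cases j <;> simp [axisPoint, translation] <;> fun_prop

theorem dist_axisPoint (s t : ℝ) : dist (axisPoint s) (axisPoint t) = |s - t| := by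
  change H3.hdist _ _ = _
  rw [H3.hdist, H3.coshDist_coord (axisPoint_coord s) (axisPoint_coord t), ← Real.exp_add,
    ← Real.exp_add]
  have h : (Real.exp (-s + t) + Real.exp (s + -t)) / 2 - (0 * 0 + 0 * 0) =
      Real.cosh |s - t| := by
    rw [Real.cosh_abs, Real.cosh_eq]; ring_nf
  rw [h, Real.arcosh_cosh (abs_nonneg _)]

/-- The geodesic segment between two points of the axis. -/
theorem exists_eq_axisPoint_of_mem_geodesicSegment {Z : H3} {t : ℝ}
    (hZ : Z ∈ H3.geodesicSegment H3.origin (axisPoint t)) :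
    ∃ s ∈ Set.uIcc 0 t, Z = axisPoint s := by
  change dist H3.origin Z + dist Z (axisPoint t) = dist H3.origin (axisPoint t) at hZ
  rw [← axisPoint_zero, dist_axisPoint, zero_sub, abs_neg] at hZ
  obtain ⟨p, q, a, b, hp, hq, h, hmat⟩ := H3.exists_coord Z
  -- Coordinates relative to the axis: `k` is the hyperbolic cosine of the distance from `Z` to the
  -- axis, and `s` below is the parameter of the foot of the perpendicular.
  set k := √(p * q) with hk
  have hpq : 0 < p * q := mul_pos hp hq
  have hkk : k * k = p * q := Real.mul_self_sqrt hpq.le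
  have hk0 : 0 < k := Real.sqrt_pos.2 hpq
  have hk1 : 1 ≤ k := by nlinarith [sq_nonneg a, sq_nonneg b]
  set s := Real.log (p / k) with hs
  have hes : Real.exp s = p / k := Real.exp_log (div_pos hp hk0)
  have hp' : p = k * Real.exp s := by rw [hes]; field_simp
  have hq' : q = k * Real.exp (-s) := by
    rw [Real.exp_neg, hes, inv_div]; field_simp; nlinarith
  -- The hyperbolic Pythagorean theorem; since `k ≥ 1`, projecting to the axis does not increase
  -- distances to its points.
  have hcosh : ∀ r, H3.coshDist Z (axisPoint r) = k * Real.cosh (s - r) := by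
    intro r
    rw [H3.coshDist_coord hmat (axisPoint_coord r), hp', hq', Real.cosh_eq, mul_assoc k,
      mul_assoc k, ← Real.exp_add, ← Real.exp_add]
    ring_nf
  have hle : ∀ r, |s - r| ≤ dist Z (axisPoint r) := by
    intro r
    change _ ≤ H3.hdist _ _
    rw [← Real.arcosh_cosh (abs_nonneg (s - r)), Real.cosh_abs, H3.hdist, hcosh]
    refine (Real.arcosh_le_arcosh (Real.cosh_pos _) ?_).2 ?_ <;>
      nlinarith [Real.one_le_cosh (s - r)]
  have h0 := hle 0
  have ht := hle t
  rw [dist_comm] at h0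
  rw [sub_zero] at h0
  have htri : |t| ≤ |s| + |s - t| := by
    have := abs_sub_abs_le_abs_sub t s
    rw [abs_sub_comm t s] at this; linarith
  have e0 : dist Z (axisPoint 0) = |s| := by rw [dist_comm]; linarith
  -- Equality in the triangle inequality leaves no loss under projection, so `Z` is on the axis.
  have hk2 : k = 1 := by
    change H3.hdist _ _ = _ at e0
    have e1 := congrArg Real.cosh e0
    rw [H3.hdist, Real.cosh_arcosh (H3.one_le_coshDist _ _), hcosh, sub_zero, Real.cosh_abs] at e1
    have := Real.cosh_pos s
    exact mul_right_cancel₀ this.ne' (by rw [e1, one_mul])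
  have hab : a ^ 2 + b ^ 2 = 0 := by rw [hk2] at hkk; linarith
  have ha : a = 0 := by nlinarith [sq_nonneg a, sq_nonneg b]
  have hb : b = 0 := by nlinarith [sq_nonneg a, sq_nonneg b]
  refine ⟨s, ?_, H3.ext ?_⟩
  · have e2 : |s| + |s - t| = |t| := by linarith
    rw [Set.mem_uIcc]
    rcases abs_cases s with ⟨h1, h1'⟩ | ⟨h1, h1'⟩ <;>
      rcases abs_cases (s - t) with ⟨h2, h2'⟩ | ⟨h2, h2'⟩ <;>
      rcases abs_cases t with ⟨h3, h3'⟩ | ⟨h3, h3'⟩ <;>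
      first
        | exact Or.inl ⟨by linarith, by linarith⟩
        | exact Or.inr ⟨by linarith, by linarith⟩
  · rw [hmat, axisPoint_coord, ha, hb, hp', hq', hk2, one_mul, one_mul]

/-- Every point is a unitary image of a point of the axis. -/
theorem exists_unitary_mul_translation (Y : H3) : ∃ W ∈ Matrix.unitaryGroup (Fin 2) ℂ, ∃ t : ℝ,
    Y.mat = W * translation t * Wᴴ := by
  have hH := Y.posDef.1
  have hpos := Y.posDef.eigenvalues_pos
  have hdet := hH.det_eq_prod_eigenvalues
  rw [Y.det_eq_one, Fin.prod_univ_two] at hdet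
  have hdet' : hH.eigenvalues 0 * hH.eigenvalues 1 = 1 := by
    apply Complex.ofReal_injective
    rw [Complex.ofReal_mul, Complex.ofReal_one]
    exact hdet.symm
  -- The eigenvalues have product `1`, so they are `eᵗ` and `e⁻ᵗ` with `t` the logarithm of the
  -- first.
  refine ⟨hH.eigenvectorUnitary, hH.eigenvectorUnitary.2, Real.log (hH.eigenvalues 0), ?_⟩
  have e : translation (Real.log (hH.eigenvalues 0)) =
      Matrix.diagonal (RCLike.ofReal ∘ hH.eigenvalues) := by
    have h1 : Real.exp (-Real.log (hH.eigenvalues 0)) = hH.eigenvalues 1 := by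
      rw [Real.exp_neg, Real.exp_log (hpos 0)]
      exact inv_eq_of_mul_eq_one_right hdet'
    rw [translation, h1, Real.exp_log (hpos 0)]
    ext i j
    fin_cases i <;> fin_cases j <;> simp
  rw [e]
  conv_lhs => rw [hH.spectral_theorem]
  rfl

theorem smul_mat_of_norm_det_eq_one (g : GL (Fin 2) ℂ) (hg : ‖g.1.det‖ = 1) (X : H3) :
    (g • X).mat = g.1 * X.mat * g.1ᴴ := by
  rw [H3.mat_smul, hg, inv_one, one_smul]

/-- Any two points are moved to the axis, the first one to the origin. -/
theorem exists_smul_axisPoint (X Y : H3) : ∃ g : GL (Fin 2) ℂ, ‖g.1.det‖ = 1 ∧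
    g • H3.origin = X ∧ ∃ t, g • axisPoint t = Y := by
  obtain ⟨g₀, rfl⟩ := H3.exists_smul_origin X
  obtain ⟨c, hc, hcg⟩ := exists_unit_smul_mul_conjTranspose g₀
  have hn := norm_det_eq_one_of_mul_conjTranspose hcg
  set g₁ := Matrix.GeneralLinearGroup.mkOfDetNeZero ((c : ℂ) • g₀.1) (by
    rw [← norm_ne_zero_iff, hn]; exact one_ne_zero) with hg₁
  have hg₁o : g₁ • H3.origin = g₀ • H3.origin := by
    refine H3.ext ?_
    rw [smul_mat_of_norm_det_eq_one g₁ hn, ← hcg]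
    change ((c : ℂ) • g₀.1) * 1 * _ = _
    rw [Matrix.mul_one]; rfl
  obtain ⟨Z, rfl⟩ : ∃ Z, g₁ • Z = Y := ⟨g₁⁻¹ • Y, smul_inv_smul g₁ Y⟩
  -- A unitary matrix fixes the origin, so composing with `W` puts the second point on the axis
  -- without moving the first.
  obtain ⟨W, hW, t, hWt⟩ := exists_unitary_mul_translation Z
  have hWW : W * Wᴴ = 1 := Matrix.mem_unitaryGroup_iff.1 hW
  have hWn : ‖W.det‖ = 1 := norm_det_eq_one_of_mul_conjTranspose (X := H3.origin) hWW
  set g₂ := Matrix.GeneralLinearGroup.mkOfDetNeZero W (by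
    rw [← norm_ne_zero_iff, hWn]; exact one_ne_zero) with hg₂
  refine ⟨g₁ * g₂, ?_, ?_, t, ?_⟩
  · change ‖(((c : ℂ) • g₀.1) * W).det‖ = 1
    rw [Matrix.det_mul, norm_mul, hn, hWn, one_mul]
  · rw [mul_smul, ← hg₁o]
    congr 1
    refine H3.ext ?_
    rw [smul_mat_of_norm_det_eq_one g₂ hWn]
    change W * 1 * Wᴴ = 1
    rw [Matrix.mul_one, hWW]
  · rw [mul_smul]
    congr 1
    refine H3.ext ?_
    rw [smul_mat_of_norm_det_eq_one g₂ hWn, hWt]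
    rfl

/-! ### Convexity and connectedness of the complement -/

/-- The parameter is halved because `A Aᴴ` squares the translation. -/
theorem smul_axisPoint_mat {g : GL (Fin 2) ℂ} (hg : ‖g.1.det‖ = 1) (t : ℝ) :
    (g • axisPoint t).mat = (g.1 * translation (t / 2)) * (g.1 * translation (t / 2))ᴴ := by
  rw [smul_mat_of_norm_det_eq_one g hg, Matrix.conjTranspose_mul, conjTranspose_translation]
  change g.1 * translation t * _ = _
  conv_lhs => rw [← add_halves t, translation_add]
  simp only [Matrix.mul_assoc]

/-- The fibres of `A ↦ A Aᴴ` over invertible matrices are cosets of the unitary group: `B⁻¹ A` is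
unitary. -/
theorem exists_unitary_of_mul_conjTranspose_eq {A B : Matrix (Fin 2) (Fin 2) ℂ}
    (hB : IsUnit B.det) (h : A * Aᴴ = B * Bᴴ) :
    ∃ V ∈ Matrix.unitaryGroup (Fin 2) ℂ, A = B * V := by
  refine ⟨B⁻¹ * A, ?_, by rw [← Matrix.mul_assoc, Matrix.mul_nonsing_inv _ hB, Matrix.one_mul]⟩
  have hBc : IsUnit (Bᴴ).det := by rw [Matrix.det_conjTranspose]; exact hB.star
  rw [Matrix.mem_unitaryGroup_iff, Matrix.star_eq_conjTranspose, Matrix.conjTranspose_mul,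
    Matrix.conjTranspose_nonsing_inv]
  calc B⁻¹ * A * (Aᴴ * (Bᴴ)⁻¹) = B⁻¹ * (A * Aᴴ) * (Bᴴ)⁻¹ := by simp only [Matrix.mul_assoc]
    _ = (B⁻¹ * B) * (Bᴴ * (Bᴴ)⁻¹) := by rw [h]; simp only [Matrix.mul_assoc]
    _ = 1 := by rw [Matrix.nonsing_inv_mul _ hB, Matrix.mul_nonsing_inv _ hBc, Matrix.one_mul]

theorem smul_axisPoint_notMem_amoeba_iff {F : MvPolynomial (Fin 4) ℂ} {d : ℕ}
    (hF : F.IsHomogeneous d) {g : GL (Fin 2) ℂ} (hg : ‖g.1.det‖ = 1) (t : ℝ) :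
    g • axisPoint t ∉ amoeba (zeroLocus F) ↔ ∀ V ∈ Matrix.unitaryGroup (Fin 2) ℂ,
      MvPolynomial.eval (toVec (g.1 * translation (t / 2) * V)) F ≠ 0 := by
  rw [mem_amoeba_zeroLocus_iff hF, smul_axisPoint_mat hg]
  constructor
  · intro h V hV h0
    refine h ⟨_, ?_, h0⟩
    have hVV : V * Vᴴ = 1 := Matrix.mem_unitaryGroup_iff.1 hV
    rw [Matrix.conjTranspose_mul _ V, Matrix.mul_assoc, ← Matrix.mul_assoc V, hVV, Matrix.one_mul]
  · rintro h ⟨A, hA, hA0⟩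
    have hu : IsUnit (g.1 * translation (t / 2)).det := by
      rw [Matrix.det_mul, det_translation, mul_one]
      exact (Matrix.isUnit_iff_isUnit_det _).1 g.isUnit
    obtain ⟨V, hV, rfl⟩ := exists_unitary_of_mul_conjTranspose_eq hu hA
    exact h V hV hA0

theorem smul_axisPoint_notMem_amoeba {F : MvPolynomial (Fin 4) ℂ} {d : ℕ}
    (hF : F.IsHomogeneous d) {g : GL (Fin 2) ℂ} (hg : ‖g.1.det‖ = 1) {s t : ℝ}
    (h0 : g • H3.origin ∉ amoeba (zeroLocus F)) (ht : g • axisPoint t ∉ amoeba (zeroLocus F))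
    (hs : s ∈ Set.uIcc 0 t) : g • axisPoint s ∉ amoeba (zeroLocus F) := by
  rw [← axisPoint_zero] at h0
  rw [smul_axisPoint_notMem_amoeba_iff hF hg] at h0 ht ⊢
  intro V hV
  refine eval_translation_ne_zero hF ?_ ht ?_ hV
  · intro U hU
    have := h0 U hU
    rwa [zero_div, translation_zero, Matrix.mul_one] at this
  · rw [Set.mem_uIcc] at hs ⊢
    rcases hs with ⟨h1, h2⟩ | ⟨h1, h2⟩
    · exact Or.inl ⟨by linarith, by linarith⟩
    · exact Or.inr ⟨by linarith, by linarith⟩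

/-- An isometry moves the segment to the axis with one end at the origin; the matrix `g` of this
isometry becomes the `M` of the zero count. -/
theorem isConvex_compl_amoeba_zeroLocus {F : MvPolynomial (Fin 4) ℂ} {d : ℕ}
    (hF : F.IsHomogeneous d) : H3.IsConvex (amoeba (zeroLocus F))ᶜ := by
  intro x hx y hy z hz
  obtain ⟨g, hg, rfl, t, rfl⟩ := exists_smul_axisPoint x y
  obtain ⟨Z, rfl⟩ : ∃ Z, g • Z = z := ⟨g⁻¹ • z, smul_inv_smul g z⟩
  change dist _ _ + dist _ _ = dist _ _ at hz
  rw [dist_smul, dist_smul, dist_smul] at hz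
  obtain ⟨s, hs, rfl⟩ := exists_eq_axisPoint_of_mem_geodesicSegment hz
  exact smul_axisPoint_notMem_amoeba hF hg hx hy hs

/-- Any two points of `K` are joined by an image of an interval of the axis, which consists of
points metrically between them. -/
theorem H3.IsConvex.isPreconnected {K : Set H3} (hK : H3.IsConvex K) : IsPreconnected K := by
  refine isPreconnected_of_forall_pair fun x hx y hy => ?_
  obtain ⟨g, -, rfl, t, rfl⟩ := exists_smul_axisPoint x y
  refine ⟨(fun s => g • axisPoint s) '' Set.uIcc 0 t, ?_,
    ⟨0, Set.left_mem_uIcc, congrArg (g • ·) axisPoint_zero⟩, ⟨t, Set.right_mem_uIcc, rfl⟩,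
    isPreconnected_uIcc.image _
      ((H3.continuous_smul_left g).comp continuous_axisPoint).continuousOn⟩
  rintro _ ⟨s, hs, rfl⟩
  refine hK _ hx _ hy ?_
  change dist _ _ + dist _ _ = dist _ _
  rw [dist_smul, dist_smul, dist_smul, ← axisPoint_zero, dist_axisPoint, dist_axisPoint,
    dist_axisPoint]
  rcases Set.mem_uIcc.1 hs with ⟨h1, h2⟩ | ⟨h1, h2⟩
  · rw [abs_of_nonpos (by linarith), abs_of_nonpos (by linarith), abs_of_nonpos (by linarith)]
    ring
  · rw [abs_of_nonneg (by linarith), abs_of_nonneg (by linarith), abs_of_nonneg (by linarith)]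
    ring

end HyperbolicAmoeba

theorem mainTheorem1 (S : Set HyperbolicAmoeba.CP3) (hS : HyperbolicAmoeba.IsSurface S)
    (hSQ : S ≠ HyperbolicAmoeba.quadric) :
    IsOpen (HyperbolicAmoeba.amoeba S)ᶜ ∧
      HyperbolicAmoeba.H3.IsConvex (HyperbolicAmoeba.amoeba S)ᶜ ∧
      IsPreconnected (HyperbolicAmoeba.amoeba S)ᶜ := by
  obtain ⟨d, F, -, -, hF, rfl⟩ := hS
  have hconv := HyperbolicAmoeba.isConvex_compl_amoeba_zeroLocus hF
  exact ⟨(HyperbolicAmoeba.isClosed_amoeba_zeroLocus hF).isOpen_compl, hconv,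
    hconv.isPreconnected⟩
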